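/- Let $\mathcal S$ be a numerical semigroup minimally generated by $A=\{a_1,\ldots,a_n\}$; that is, $a_1,\ldots,a_n$ are distinct relatively prime positive integers, $\mathcal S=\langle A\rangle=\{u_1a_1+\cdots+u_na_n \mid u_i\in\mathbb N\}$, and no proper subset of $A$ generates $\mathcal S$. Let $\mathbb K$ be an arbitrary field, and let $$I_A=\langle \mathbf x^{\mathbf u}-\mathbf x^{\mathbf v} \mid \mathbf u,\mathbf v\in\mathbb N^n,\ \textstyle\sum_i u_ia_i=\sum_i v_ia_i\rangle\subseteq \mathbb K[x_1,\ldots,x_n]$$ be the toric ideal of $A$. A binomial is a polynomial $\mathbf x^{\mathbf u}-\mathbf x^{\mathbf v}$ with $\mathbf u\neq\mathbf v$. The semigroup $\mathcal S$ is called universally free if for every arrangement $(b_1,\ldots,b_n)$ of the elements of $A$ and every $i\in\{1,\ldots,n-1\}$ one has $\operatorname{lcm}\bigl(b_i,\gcd(b_{i+1},\ldots,b_n)\bigr)\in\langle b_{i+1},\ldots,b_n\rangle$. A circuit of $I_A$ is a binomial $\mathbf x^{\mathbf u}-\mathbf x^{\mathbf v}\in I_A$ such that $\operatorname{supp}(\mathbf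 u)\cap\operatorname{supp}(\mathbf v)=\emptyset$, the nonzero entries of $\mathbf u+\mathbf v$ are relatively prime, and there is no binomial $\mathbf x^{\mathbf u'}-\mathbf x^{\mathbf v'}\in I_A$ with $\operatorname{supp}(\mathbf u')\cup\operatorname{supp}(\mathbf v')\subsetneq\operatorname{supp}(\mathbf u)\cup\operatorname{supp}(\mathbf v)$. Let $\mathcal C_A$ be the set of circuits of $I_A$. A Markov basis of $I_A$ is a set of binomials that generates $I_A$ and is minimal for inclusion among such sets. Let $\mathcal M_A$ be the union of all Markov bases of $I_A$; its elements are called minimal binomials. If $\mathcal S$ is universally free, then every circuit of $I_A$ is a minimal binomial, that is, $\mathcal C_A\subseteq\mathcal M_A$. -/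

import Mathlib

open MvPolynomial

noncomputable section

/-- A numerical semigroup: a submonoid of `ℕ` generated by a finite set of relatively prime
positive integers. -/
def IsNumericalSemigroup (S : AddSubmonoid ℕ) : Prop :=
  ∃ A : Finset ℕ, (∀ x ∈ A, 0 < x) ∧ A.gcd id = 1 ∧ AddSubmonoid.closure (A : Set ℕ) = S

/-- `(a 0, …, a (n-1))` is an arrangement (an enumeration without repetition) of the minimal
generating set of `S`: the `a i` are distinct positive integers that generate `S`, and no proper
subset of `{a 0, …, a (n-1)}` generates `S`. -/
structure IsMinimalArrangement {n : ℕ} (a : Fin n → ℕ) (S : AddSubmonoid ℕ) : Prop where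
  injective : Function.Injective a
  pos : ∀ i, 0 < a i
  closure_eq : AddSubmonoid.closure (Set.range a) = S
  minimal : ∀ B : Set ℕ, B ⊂ Set.range a → AddSubmonoid.closure B ≠ S

/-- Freeness for the arrangement `(a 0, …, a (n-1))`: for each index `i` other than the last one,
`lcm (a i, gcd (a (i+1), …, a (n-1)))` belongs to `⟨a (i+1), …, a (n-1)⟩`. -/
def IsFreeFor {n : ℕ} (a : Fin n → ℕ) : Prop :=
  ∀ i : Fin n, (i : ℕ) + 1 < n →
    Nat.lcm (a i) ((Finset.Ioi i).gcd a) ∈ AddSubmonoid.closure (a '' Set.Ioi i)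

/-- `S` is universally free: it is free for any arrangement of its minimal generating set. -/
def IsUniversallyFree (S : AddSubmonoid ℕ) : Prop :=
  ∀ (n : ℕ) (a : Fin n → ℕ), IsMinimalArrangement a S → IsFreeFor a

/-- The `A`-degree `∑ i, u i * a i` of the monomial with exponent vector `u`. -/
def degA {n : ℕ} (a : Fin n → ℕ) (u : Fin n →₀ ℕ) : ℕ :=
  ∑ i, u i * a i

/-- The pure difference `x ^ u - x ^ v`. -/
def pureDiff (K : Type*) [Field K] {n : ℕ} (u v : Fin n →₀ ℕ) : MvPolynomial (Fin n) K :=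
  monomial u 1 - monomial v 1

/-- The toric ideal `I_A`, generated by the `A`-homogeneous pure differences. -/
def toricIdeal (K : Type*) [Field K] {n : ℕ} (a : Fin n → ℕ) : Ideal (MvPolynomial (Fin n) K) :=
  Ideal.span {f | ∃ u v : Fin n →₀ ℕ, degA a u = degA a v ∧ f = pureDiff K u v}

/-- A (pure difference) binomial is a difference of two distinct monomials. -/
def IsBinomial {K : Type*} [Field K] {n : ℕ} (f : MvPolynomial (Fin n) K) : Prop :=
  ∃ u v : Fin n →₀ ℕ, u ≠ v ∧ f = pureDiff K u v

/-- The set of circuits of `I_A`: the binomials `x ^ u - x ^ v` of `I_A` that are irreducible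
(`u` and `v` have disjoint supports and the nonzero entries of `u + v` are relatively prime) and
whose support is minimal among the supports of the binomials of `I_A`. -/
def circuits (K : Type*) [Field K] {n : ℕ} (a : Fin n → ℕ) : Set (MvPolynomial (Fin n) K) :=
  {f | ∃ u v : Fin n →₀ ℕ, u ≠ v ∧ f = pureDiff K u v ∧ f ∈ toricIdeal K a ∧
    Disjoint u.support v.support ∧ (u + v).support.gcd (u + v) = 1 ∧
    ¬ ∃ u' v' : Fin n →₀ ℕ, u' ≠ v' ∧ pureDiff K u' v' ∈ toricIdeal K a ∧
      u'.support ∪ v'.support ⊂ u.support ∪ v.support}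

/-- A Markov basis of `I_A`: a set of binomials generating `I_A` that is minimal for inclusion
among such sets. -/
def IsMarkovBasis {K : Type*} [Field K] {n : ℕ} (a : Fin n → ℕ)
    (B : Set (MvPolynomial (Fin n) K)) : Prop :=
  Minimal (fun B : Set (MvPolynomial (Fin n) K) =>
    (∀ f ∈ B, IsBinomial f) ∧ Ideal.span B = toricIdeal K a) B

/-- The universal Markov basis: the union of all Markov bases of `I_A`. Replacing an element of
a Markov basis by its negative gives a Markov basis, so this set contains each of its elements
with both signs. -/
def universalMarkovBasis (K : Type*) [Field K] {n : ℕ} (a : Fin n → ℕ) :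
    Set (MvPolynomial (Fin n) K) :=
  ⋃₀ {B | IsMarkovBasis a B}

end

/-! A circuit has the form `x_i ^ p - x_j ^ q` with `p * a i = q * a j = lcm (a i) (a j)`
(`exists_single_of_mem_circuits`, `mul_eq_lcm_of_coprime`). Arrange the generators so that `i` and
`j` come last. Freeness for this arrangement gives, for each position but the last, a binomial whose
leading variable occurs to the least exponent that later variables allow
(`exists_triangular_of_isFreeFor`). Eliminating variables in turn shows that these binomials
generate the toric ideal (`pureDiff_mem_of_triangular`). None is redundant: the triangular shape
allows rational weights for which all of them but one are homogeneous
(`exists_weight_of_triangular`, `weightOf_eq_of_mem_span`). So they form a Markov basis, and its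
penultimate-position element is the circuit. -/

/-! ### Rational weights -/

/-- The weight of an exponent vector `u` for rational weights `χ` of the variables. -/
def weightOf {n : ℕ} (χ : Fin n → ℚ) (u : Fin n →₀ ℕ) : ℚ :=
  ∑ i, (u i : ℚ) * χ i

theorem degA_add {n : ℕ} (a : Fin n → ℕ) (u v : Fin n →₀ ℕ) :
    degA a (u + v) = degA a u + degA a v := by
  simp [degA, add_mul, Finset.sum_add_distrib]

theorem degA_smul {n : ℕ} (a : Fin n → ℕ) (t : ℕ) (u : Fin n →₀ ℕ) :
    degA a (t • u) = t * degA a u := by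
  simp [degA, mul_assoc, Finset.mul_sum]

theorem degA_single {n : ℕ} (a : Fin n → ℕ) (i : Fin n) (p : ℕ) :
    degA a (Finsupp.single i p) = p * a i := by
  simp [degA, Finsupp.single_apply, ite_mul]

theorem weightOf_single {n : ℕ} (χ : Fin n → ℚ) (i : Fin n) (p : ℕ) :
    weightOf χ (Finsupp.single i p) = p * χ i := by
  simp [weightOf, Finsupp.single_apply, ite_mul]

/-- The homomorphism to the group algebra of `ℚ` sending `x_i` to the element `χ i`. -/
noncomputable def weightHom (K : Type*) [Field K] {n : ℕ} (χ : Fin n → ℚ) :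
    MvPolynomial (Fin n) K →ₐ[K] AddMonoidAlgebra K ℚ :=
  aeval fun i => AddMonoidAlgebra.single (χ i) 1

theorem weightHom_monomial (K : Type*) [Field K] {n : ℕ} (χ : Fin n → ℚ) (u : Fin n →₀ ℕ) :
    weightHom K χ (monomial u 1) = AddMonoidAlgebra.single (weightOf χ u) 1 := by
  have key : ∀ s : Finset (Fin n),
      ∏ i ∈ s, (AddMonoidAlgebra.single (χ i) (1 : K)) ^ u i =
        AddMonoidAlgebra.single (∑ i ∈ s, (u i : ℚ) * χ i) 1 := by
    intro s
    induction s using Finset.induction_on with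
    | empty => simp [AddMonoidAlgebra.one_def]
    | insert i s hi ih =>
      rw [Finset.prod_insert hi, Finset.sum_insert hi, ih, AddMonoidAlgebra.single_pow,
        AddMonoidAlgebra.single_mul_single]
      simp
  rw [weightHom, aeval_monomial, map_one, one_mul,
    Finsupp.prod_fintype _ _ (fun i => pow_zero _), key, weightOf]

/-- If an ideal is generated by weight-homogeneous pure differences, then so is any pure
difference in it. -/
theorem weightOf_eq_of_mem_span {K : Type*} [Field K] {n : ℕ} (χ : Fin n → ℚ)
    {G : Set (MvPolynomial (Fin n) K)}
    (hG : ∀ f ∈ G, ∃ u v, weightOf χ u = weightOf χ v ∧ f = pureDiff K u v)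
    {u v : Fin n →₀ ℕ} (h : pureDiff K u v ∈ Ideal.span G) : weightOf χ u = weightOf χ v := by
  -- Monomials map to basis elements indexed by their weights, so a pure difference is killed only
  -- if its two weights agree.
  have hle : Ideal.span G ≤ RingHom.ker (weightHom K χ) := by
    rw [Ideal.span_le]
    intro f hf
    obtain ⟨u, v, huv, rfl⟩ := hG f hf
    simp [RingHom.mem_ker, pureDiff, weightHom_monomial, huv]
  have h0 := hle h
  rw [RingHom.mem_ker, pureDiff, map_sub, weightHom_monomial, weightHom_monomial,
    sub_eq_zero] at h0
  exact AddMonoidAlgebra.single_left_injective (one_ne_zero) h0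

/-- The `A`-degree is itself a weight, for which the defining generators are homogeneous. -/
theorem degA_eq_of_pureDiff_mem {K : Type*} [Field K] {n : ℕ} {a : Fin n → ℕ}
    {u v : Fin n →₀ ℕ} (h : pureDiff K u v ∈ toricIdeal K a) : degA a u = degA a v := by
  have key : ∀ u, weightOf (fun i => (a i : ℚ)) u = (degA a u : ℚ) := by
    intro u; simp [weightOf, degA]
  have := weightOf_eq_of_mem_span (fun i => (a i : ℚ)) (G := _) (by
    rintro f ⟨u, v, huv, rfl⟩
    exact ⟨u, v, by rw [key, key, huv], rfl⟩) h
  rw [key, key] at this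
  exact_mod_cast this

/-- A strictly triangular system with nonzero diagonal is solvable. -/
theorem exists_weight_of_triangular {n : ℕ} (r : Fin n → ℕ) (hr : Function.Injective r)
    (c : Fin n → ℕ) (w : Fin n → (Fin n →₀ ℕ)) (hc : ∀ i, 0 < c i)
    (hw : ∀ i j, w i j ≠ 0 → r i < r j) (y : Fin n → ℚ) :
    ∃ χ : Fin n → ℚ, ∀ i, weightOf χ (Finsupp.single i (c i)) - weightOf χ (w i) = y i := by
  -- Back substitution from the highest rank down. The threshold exceeds every rank, so `m = 0` is
  -- vacuous and `m` equal to the threshold covers all equations.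
  have key : ∀ m : ℕ, ∃ χ : Fin n → ℚ, ∀ i, n.succ + Finset.univ.sup r ≤ r i + m →
      (c i : ℚ) * χ i - weightOf χ (w i) = y i := by
    intro m
    induction m with
    | zero =>
      refine ⟨0, fun i hi => ?_⟩
      have := Finset.le_sup (f := r) (Finset.mem_univ i)
      omega
    | succ m ih =>
      obtain ⟨χ, hχ⟩ := ih
      by_cases h : ∃ k, n.succ + Finset.univ.sup r = r k + (m + 1)
      · obtain ⟨k, hk⟩ := h
        -- Equations already solved, and equation `k` itself, have no `χ k` in their `w` part, so
        -- this update disturbs none of them.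
        refine ⟨Function.update χ k ((y k + weightOf χ (w k)) / c k), fun i hi => ?_⟩
        have hwi : weightOf (Function.update χ k ((y k + weightOf χ (w k)) / c k)) (w i) =
            weightOf χ (w i) := by
          refine Finset.sum_congr rfl fun j _ => ?_
          by_cases hj : w i j = 0
          · simp [hj]
          · have := hw i j hj
            have hjk : j ≠ k := by rintro rfl; omega
            rw [Function.update_of_ne hjk]
        rw [hwi]
        by_cases hik : i = k
        · subst hik
          have : (c i : ℚ) ≠ 0 := by exact_mod_cast (hc i).ne'
          rw [Function.update_self]
          field_simp
          ring
        · rw [Function.update_of_ne hik]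
          refine hχ i ?_
          have : r i ≠ r k := fun h => hik (hr h)
          omega
      · refine ⟨χ, fun i hi => hχ i ?_⟩
        push Not at h
        have := h i
        omega
  obtain ⟨χ, hχ⟩ := key (n.succ + Finset.univ.sup r)
  exact ⟨χ, fun i => by rw [weightOf_single]; exact hχ i (by omega)⟩

/-! ### Degrees, and congruence of monomials modulo an ideal -/

theorem exists_degA_eq_of_mem_closure {n : ℕ} (a : Fin n → ℕ) (T : Set (Fin n)) {x : ℕ}
    (hx : x ∈ AddSubmonoid.closure (a '' T)) :
    ∃ w : Fin n →₀ ℕ, (∀ j, w j ≠ 0 → j ∈ T) ∧ degA a w = x := by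
  induction hx using AddSubmonoid.closure_induction with
  | mem x hx =>
    obtain ⟨i, hi, rfl⟩ := hx
    refine ⟨Finsupp.single i 1, fun j hj => ?_, by simp [degA_single]⟩
    by_cases h : i = j
    · exact h ▸ hi
    · exact absurd (Finsupp.single_eq_of_ne' h) hj
  | zero => exact ⟨0, by simp, by simp [degA]⟩
  | add x y _ _ hx hy =>
    obtain ⟨u, hu, rfl⟩ := hx
    obtain ⟨v, hv, rfl⟩ := hy
    refine ⟨u + v, fun j hj => ?_, degA_add a u v⟩
    by_cases h : u j = 0
    · exact hv j fun h' => hj (by simp [h, h'])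
    · exact hu j h

theorem dvd_degA {n : ℕ} (a : Fin n → ℕ) (T : Finset (Fin n)) {u : Fin n →₀ ℕ}
    (hu : ∀ j, u j ≠ 0 → j ∈ T) : T.gcd a ∣ degA a u := by
  refine Finset.dvd_sum fun j _ => ?_
  by_cases h : u j = 0
  · simp [h]
  · exact Dvd.dvd.mul_left (Finset.gcd_dvd (hu j h)) _

theorem pureDiff_mem_comm {K : Type*} [Field K] {n : ℕ} {I : Ideal (MvPolynomial (Fin n) K)}
    {u v : Fin n →₀ ℕ} (h : pureDiff K u v ∈ I) : pureDiff K v u ∈ I := by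
  have := I.neg_mem h
  rwa [pureDiff, neg_sub] at this

theorem pureDiff_mem_trans {K : Type*} [Field K] {n : ℕ} {I : Ideal (MvPolynomial (Fin n) K)}
    {u v w : Fin n →₀ ℕ} (h : pureDiff K u v ∈ I) (h' : pureDiff K v w ∈ I) :
    pureDiff K u w ∈ I := by
  have := I.add_mem h h'
  rwa [pureDiff, pureDiff, sub_add_sub_cancel] at this

theorem pureDiff_mem_add {K : Type*} [Field K] {n : ℕ} {I : Ideal (MvPolynomial (Fin n) K)}
    {u v : Fin n →₀ ℕ} (w : Fin n →₀ ℕ) (h : pureDiff K u v ∈ I) :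
    pureDiff K (u + w) (v + w) ∈ I := by
  have := I.mul_mem_right (monomial w 1) h
  rwa [pureDiff, sub_mul, monomial_mul, monomial_mul, one_mul] at this

theorem pureDiff_mem_smul {K : Type*} [Field K] {n : ℕ} {I : Ideal (MvPolynomial (Fin n) K)}
    {u v : Fin n →₀ ℕ} (t : ℕ) (h : pureDiff K u v ∈ I) :
    pureDiff K (t • u) (t • v) ∈ I := by
  induction t with
  | zero => simp [pureDiff]
  | succ t ih =>
    rw [succ_nsmul, succ_nsmul]
    refine pureDiff_mem_trans (pureDiff_mem_add u ih) ?_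
    rw [add_comm _ u, add_comm _ v]
    exact pureDiff_mem_add _ h

/-! ### Triangular Markov bases -/

/-- Triangular binomials `x_i ^ c_i - x ^ w_i` for which every relation has its leading exponent
divisible by `c_i` generate the toric ideal. -/
theorem pureDiff_mem_of_triangular {K : Type*} [Field K] {n : ℕ} {a : Fin n → ℕ}
    (hpos : ∀ i, 0 < a i) (e : Equiv.Perm (Fin n)) (c : Fin n → ℕ) (w : Fin n → (Fin n →₀ ℕ))
    (hw : ∀ k j, w k (e j) ≠ 0 → k < j)
    (hdeg : ∀ k : Fin n, (k : ℕ) + 1 < n → c k * a (e k) = degA a (w k))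
    (hdvd : ∀ k : Fin n, (k : ℕ) + 1 < n → ∀ t (u v : Fin n →₀ ℕ), (∀ j, u (e j) ≠ 0 → k < j) →
      (∀ j, v (e j) ≠ 0 → k < j) → t * a (e k) + degA a u = degA a v → c k ∣ t)
    {I : Ideal (MvPolynomial (Fin n) K)}
    (hI : ∀ k : Fin n, (k : ℕ) + 1 < n → pureDiff K (Finsupp.single (e k) (c k)) (w k) ∈ I) :
    ∀ u v : Fin n →₀ ℕ, degA a u = degA a v → pureDiff K u v ∈ I := by
  -- Induction on `m`, the number of final positions that the two monomials may involve.
  have key : ∀ m ≤ n, ∀ u v : Fin n →₀ ℕ, (∀ j : Fin n, u (e j) ≠ 0 → n ≤ j + m) →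
      (∀ j : Fin n, v (e j) ≠ 0 → n ≤ j + m) → degA a u = degA a v → pureDiff K u v ∈ I := by
    intro m
    induction m with
    | zero =>
      intro _ u v hu hv _
      have h0 : ∀ u : Fin n →₀ ℕ, (∀ j : Fin n, u (e j) ≠ 0 → n ≤ j + 0) → u = 0 := by
        intro u hu
        ext j
        by_contra h
        have := hu (e.symm j) (by simpa using h)
        omega
      simp [h0 u hu, h0 v hv, pureDiff]
    | succ m ih =>
      intro hm u v hu hv huv
      wlog hle : v (e ⟨n - (m + 1), by omega⟩) ≤ u (e ⟨n - (m + 1), by omega⟩) generalizing u v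
      · exact pureDiff_mem_comm (this v u hv hu huv.symm (le_of_not_ge hle))
      set k : Fin n := ⟨n - (m + 1), by omega⟩ with hk
      have hkv : (k : ℕ) = n - (m + 1) := rfl
      obtain ⟨t, ht⟩ := Nat.exists_eq_add_of_le hle
      have her : ∀ x : Fin n →₀ ℕ, (∀ j : Fin n, x (e j) ≠ 0 → n ≤ j + (m + 1)) →
          ∀ j, (x.erase (e k)) (e j) ≠ 0 → k < j := by
        intro x hx j hj
        by_cases hjk : j = k
        · subst hjk; simp at hj
        · rw [Finsupp.erase_ne (fun h => hjk (e.injective h))] at hj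
          have := hx j hj
          have : (j : ℕ) ≠ k := fun h => hjk (Fin.ext h)
          rw [Fin.lt_def]; omega
      have hlt : ∀ j : Fin n, k < j → n ≤ j + m := by
        intro j hj; rw [Fin.lt_def] at hj; omega
      have hu' := her u hu
      have hv' := her v hv
      have eu := Finsupp.single_add_erase (e k) u
      have ev := Finsupp.single_add_erase (e k) v
      set u' := u.erase (e k)
      set v' := v.erase (e k)
      have hrel : t * a (e k) + degA a u' = degA a v' := by
        rw [← eu, ← ev, degA_add, degA_add, degA_single, degA_single, ht, add_mul] at huv
        omega
      rw [← eu, ← ev, ht]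
      by_cases hkn : (k : ℕ) + 1 < n
      -- The excess power of the leading variable is a power of `x ^ c k`; replacing it by `s • w k`
      -- leaves only later variables.
      · obtain ⟨s, rfl⟩ := hdvd k hkn t u' v' hu' hv' hrel
        have h1 := pureDiff_mem_add (Finsupp.single (e k) (v (e k)) + u')
          (pureDiff_mem_smul s (hI k hkn))
        have h2 : pureDiff K (s • w k + u') v' ∈ I := by
          refine ih (by omega) _ _ (fun j hj => hlt j ?_) (fun j hj => hlt j (hv' j hj)) ?_
          · by_cases h : u' (e j) = 0
            · refine hw k j fun h' => hj ?_
              simp [h, h']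
            · exact hu' j h
          · rw [degA_add, degA_smul, ← hdeg k hkn, ← hrel]; ring
        have h3 := pureDiff_mem_add (Finsupp.single (e k) (v (e k))) h2
        have e1 : Finsupp.single (e k) (v (e k) + c k * s) + u' =
            s • Finsupp.single (e k) (c k) + (Finsupp.single (e k) (v (e k)) + u') := by
          rw [Finsupp.single_add, Finsupp.smul_single, smul_eq_mul, mul_comm s]; abel
        rw [e1, add_comm _ v']
        refine pureDiff_mem_trans h1 ?_
        convert h3 using 2
        abel
      -- At the last position no later variable exists, so positivity of degrees forces equal
      -- exponents.
      · have h0 : ∀ x : Fin n →₀ ℕ, (∀ j, x (e j) ≠ 0 → k < j) → x = 0 := by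
          intro x hx
          ext j
          by_contra h
          have := hx (e.symm j) (by simpa using h)
          rw [Fin.lt_def] at this
          omega
        rw [h0 u' hu', h0 v' hv'] at hrel ⊢
        have ht0 : t = 0 := by
          have := (hpos (e k)).ne'
          simpa [degA, this] using hrel
        simp [ht0, pureDiff]
  intro u v huv
  exact key n le_rfl u v (fun j _ => by omega) (fun j _ => by omega) huv

/-- The triangular binomials attached to a free arrangement form a Markov basis. -/
theorem isMarkovBasis_of_triangular {K : Type*} [Field K] {n : ℕ} {a : Fin n → ℕ}
    (hpos : ∀ i, 0 < a i) (e : Equiv.Perm (Fin n)) (c : Fin n → ℕ) (w : Fin n → (Fin n →₀ ℕ))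
    (hc : ∀ k, 0 < c k) (hw : ∀ k j, w k (e j) ≠ 0 → k < j)
    (hdeg : ∀ k : Fin n, (k : ℕ) + 1 < n → c k * a (e k) = degA a (w k))
    (hdvd : ∀ k : Fin n, (k : ℕ) + 1 < n → ∀ t (u v : Fin n →₀ ℕ), (∀ j, u (e j) ≠ 0 → k < j) →
      (∀ j, v (e j) ≠ 0 → k < j) → t * a (e k) + degA a u = degA a v → c k ∣ t) :
    IsMarkovBasis a {f : MvPolynomial (Fin n) K | ∃ k : Fin n, (k : ℕ) + 1 < n ∧
      f = pureDiff K (Finsupp.single (e k) (c k)) (w k)} := by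
  refine ⟨⟨?_, le_antisymm ?_ ?_⟩, ?_⟩
  · rintro f ⟨k, hk, rfl⟩
    refine ⟨_, _, fun h => ?_, rfl⟩
    have h1 := DFunLike.congr_fun h (e k)
    rw [Finsupp.single_eq_same] at h1
    exact lt_irrefl k (hw k k (by have := hc k; omega))
  · rw [Ideal.span_le]
    rintro f ⟨k, hk, rfl⟩
    exact Ideal.subset_span ⟨_, _, by rw [degA_single, hdeg k hk], rfl⟩
  · rw [toricIdeal, Ideal.span_le]
    rintro f ⟨u, v, huv, rfl⟩
    exact pureDiff_mem_of_triangular hpos e c w hw hdeg hdvd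
      (fun k hk => Ideal.subset_span (Exists.intro k ⟨hk, rfl⟩)) u v huv
  · rintro B ⟨_, hB⟩ hBs f ⟨k, hk, rfl⟩
    by_contra hf
    -- The right-hand side makes the `k`-th binomial inhomogeneous and every other one homogeneous,
    -- so the others cannot generate it.
    obtain ⟨χ, hχ⟩ := exists_weight_of_triangular (fun i => (e.symm i : ℕ))
      (Fin.val_injective.comp e.symm.injective) (fun i => c (e.symm i)) (fun i => w (e.symm i))
      (fun i => hc _) (fun i j hij => hw (e.symm i) (e.symm j) (by simpa using hij))
      (Pi.single (e k) 1)
    have hχ' : ∀ j, weightOf χ (Finsupp.single (e j) (c j)) - weightOf χ (w j) =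
        (Pi.single (e k) 1 : Fin n → ℚ) (e j) := fun j => by simpa using hχ (e j)
    have hmem : pureDiff K (Finsupp.single (e k) (c k)) (w k) ∈ Ideal.span B := by
      rw [hB]
      exact Ideal.subset_span ⟨_, _, by rw [degA_single, hdeg k hk], rfl⟩
    have h := weightOf_eq_of_mem_span χ (fun g hg => by
      obtain ⟨j, hj, rfl⟩ := hBs hg
      have hjk : e j ≠ e k := fun h => hf (e.injective h ▸ hg)
      refine ⟨_, _, ?_, rfl⟩
      have := hχ' j
      rw [Pi.single_eq_of_ne hjk] at this
      exact sub_eq_zero.mp this) hmem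
    have := hχ' k
    rw [Pi.single_eq_same, h, sub_self] at this
    exact zero_ne_one this

/-! ### Triangular binomials from freeness -/

/-- A free arrangement provides triangular binomials. -/
theorem exists_triangular_of_isFreeFor {n : ℕ} {a : Fin n → ℕ} (hpos : ∀ i, 0 < a i)
    (e : Equiv.Perm (Fin n)) (hfree : IsFreeFor (a ∘ e)) (k : Fin n) :
    ∃ (c : ℕ) (w : Fin n →₀ ℕ), 0 < c ∧ (∀ j, w (e j) ≠ 0 → k < j) ∧
      ((k : ℕ) + 1 < n → c * a (e k) = degA a w ∧
        c * a (e k) = Nat.lcm (a (e k)) ((Finset.Ioi k).gcd (a ∘ e)) ∧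
        ∀ t (u v : Fin n →₀ ℕ), (∀ j, u (e j) ≠ 0 → k < j) →
          (∀ j, v (e j) ≠ 0 → k < j) → t * a (e k) + degA a u = degA a v → c ∣ t) := by
  by_cases hk : (k : ℕ) + 1 < n
  swap
  -- The last position yields no binomial; these values only keep the system triangular with nonzero
  -- diagonal.
  · exact ⟨1, 0, one_pos, by simp, fun h => absurd h hk⟩
  have hmem := hfree k hk
  rw [Set.image_comp] at hmem
  obtain ⟨w, hw, hwdeg⟩ := exists_degA_eq_of_mem_closure a _ hmem
  obtain ⟨c, hcl⟩ := Nat.dvd_lcm_left (a (e k)) ((Finset.Ioi k).gcd (a ∘ e))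
  have hg : 0 < (Finset.Ioi k).gcd (a ∘ e) := by
    refine Nat.pos_of_ne_zero fun h => ?_
    rw [Finset.gcd_eq_zero_iff] at h
    exact (hpos _).ne' (h ⟨k + 1, hk⟩ (by simp [Fin.lt_def]))
  have hl := Nat.lcm_pos (hpos (e k)) hg
  refine ⟨c, w, Nat.pos_of_ne_zero (by rintro rfl; omega), fun j hj => ?_, fun _ =>
    ⟨by rw [hwdeg, mul_comm]; exact hcl.symm, by rw [mul_comm]; exact hcl.symm,
      fun t u v hu hv h => ?_⟩⟩
  · obtain ⟨j', hj', h⟩ := hw _ hj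
    exact e.injective h ▸ hj'
  · have hdvd : ∀ u : Fin n →₀ ℕ, (∀ j, u (e j) ≠ 0 → k < j) →
        (Finset.Ioi k).gcd (a ∘ e) ∣ degA a u := by
      intro u hu
      have := dvd_degA a ((Finset.Ioi k).map e.toEmbedding) (u := u) (fun j hj => by
        have := hu (e.symm j) (by simpa using hj)
        simpa using this)
      rwa [Finset.map_eq_image, Finset.gcd_image] at this
    -- Both remaining degrees are multiples of the gcd, hence so is `t * a (e k)`; it is then a
    -- multiple of the lcm, which is `c * a (e k)`.
    have h1 : (Finset.Ioi k).gcd (a ∘ e) ∣ t * a (e k) :=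
      (Nat.dvd_add_left (hdvd u hu)).mp (h ▸ hdvd v hv)
    have h2 := Nat.lcm_dvd (Dvd.intro_left t rfl) h1
    rw [hcl, mul_comm t] at h2
    exact Nat.dvd_of_mul_dvd_mul_left (hpos _) h2

theorem exists_perm_apply_eq {α : Type*} [DecidableEq α] {x y i j : α} (hxy : x ≠ y)
    (hij : i ≠ j) : ∃ e : Equiv.Perm α, e x = i ∧ e y = j := by
  have hm : Equiv.swap y j x ≠ j := fun h => hxy <| by
    have := (Equiv.swap y j).injective (h.trans (Equiv.swap_apply_left y j).symm)
    exact this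
  refine ⟨Equiv.swap y j |>.trans (Equiv.swap (Equiv.swap y j x) i), ?_, ?_⟩
  · simp
  · rw [Equiv.trans_apply, Equiv.swap_apply_left, Equiv.swap_apply_of_ne_of_ne hm.symm hij.symm]

theorem IsMinimalArrangement.comp_perm {n : ℕ} {a : Fin n → ℕ} {S : AddSubmonoid ℕ}
    (ha : IsMinimalArrangement a S) (e : Equiv.Perm (Fin n)) :
    IsMinimalArrangement (a ∘ e) S := by
  have hr : Set.range (a ∘ e) = Set.range a := e.surjective.range_comp a
  exact ⟨ha.injective.comp e.injective, fun i => ha.pos _, hr ▸ ha.closure_eq,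
    fun B hB => ha.minimal B (hr ▸ hB)⟩

theorem eq_zero_of_degA_eq_zero {n : ℕ} {a : Fin n → ℕ} (hpos : ∀ i, 0 < a i)
    {u : Fin n →₀ ℕ} (h : degA a u = 0) : u = 0 := by
  ext i
  rw [degA, Finset.sum_eq_zero_iff] at h
  simpa [(hpos i).ne'] using h i (Finset.mem_univ i)

/-! ### Shape of the circuits -/

/-- A circuit of a toric ideal of a numerical semigroup involves exactly two variables. -/
theorem exists_single_of_mem_circuits {K : Type*} [Field K] {n : ℕ} {a : Fin n → ℕ}
    (hpos : ∀ i, 0 < a i) {f : MvPolynomial (Fin n) K} (hf : f ∈ circuits K a) :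
    ∃ (i j : Fin n) (p q : ℕ), i ≠ j ∧ Nat.Coprime p q ∧ p * a i = q * a j ∧
      f = pureDiff K (Finsupp.single i p) (Finsupp.single j q) := by
  obtain ⟨u, v, huv, rfl, hmem, hdisj, hgcd, hmin⟩ := hf
  have hdeg := degA_eq_of_pureDiff_mem hmem
  have hu : u ≠ 0 := by
    rintro rfl
    exact huv (eq_zero_of_degA_eq_zero hpos (hdeg.symm.trans (by simp [degA]))).symm
  have hv : v ≠ 0 := by
    rintro rfl
    exact huv (eq_zero_of_degA_eq_zero hpos (hdeg.trans (by simp [degA])))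
  obtain ⟨i, hi⟩ := Finsupp.support_nonempty_iff.mpr hu
  obtain ⟨j, hj⟩ := Finsupp.support_nonempty_iff.mpr hv
  have hij : i ≠ j := fun h => Finset.disjoint_left.mp hdisj hi (h ▸ hj)
  have hsub : u.support ∪ v.support ⊆ {i, j} := by
    by_contra hns
    -- With a third variable in the support, `x_i ^ (a j) - x_j ^ (a i)` would contradict
    -- minimality.
    refine hmin ⟨Finsupp.single i (a j), Finsupp.single j (a i), fun h => ?_,
      Ideal.subset_span ⟨_, _, ?_, rfl⟩, ?_⟩
    · have := DFunLike.congr_fun h i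
      rw [Finsupp.single_eq_same, Finsupp.single_eq_of_ne hij] at this
      exact (hpos j).ne' this
    · rw [degA_single, degA_single, mul_comm]
    · rw [Finsupp.support_single i (hpos j).ne',
        Finsupp.support_single j (hpos i).ne', ← Finset.insert_eq]
      refine ⟨?_, hns⟩
      intro x hx
      rcases Finset.mem_insert.mp hx with rfl | hx
      · exact Finset.mem_union_left _ hi
      · rw [Finset.mem_singleton] at hx
        subst hx
        exact Finset.mem_union_right _ hj
  have hus : u = Finsupp.single i (u i) := by
    ext x
    by_cases hx : x = i
    · simp [hx]
    rw [Finsupp.single_eq_of_ne hx]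
    by_contra hne
    have hx' := Finsupp.mem_support_iff.mpr hne
    have := hsub (Finset.mem_union_left _ hx')
    simp only [Finset.mem_insert, hx, Finset.mem_singleton, false_or] at this
    exact Finset.disjoint_left.mp hdisj hx' (this ▸ hj)
  have hvs : v = Finsupp.single j (v j) := by
    ext x
    by_cases hx : x = j
    · simp [hx]
    rw [Finsupp.single_eq_of_ne hx]
    by_contra hne
    have hx' := Finsupp.mem_support_iff.mpr hne
    have := hsub (Finset.mem_union_right _ hx')
    simp only [Finset.mem_insert, hx, Finset.mem_singleton, or_false] at this
    exact Finset.disjoint_left.mp hdisj hi (this ▸ hx')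
  refine ⟨i, j, u i, v j, hij, ?_, ?_, by rw [← hus, ← hvs]⟩
  · rw [Nat.Coprime, ← Nat.dvd_one, ← hgcd]
    refine Finset.dvd_gcd fun x hx => ?_
    have hx' := hsub (Finsupp.support_add hx)
    rw [Finset.mem_insert, Finset.mem_singleton] at hx'
    rcases hx' with rfl | rfl
    · have : v x = 0 := by rw [hvs, Finsupp.single_eq_of_ne hij]
      rw [Finsupp.add_apply, this, add_zero]
      exact Nat.gcd_dvd_left _ _
    · have : u x = 0 := by rw [hus, Finsupp.single_eq_of_ne hij.symm]
      rw [Finsupp.add_apply, this, zero_add]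
      exact Nat.gcd_dvd_right _ _
  · rwa [hus, hvs, degA_single, degA_single] at hdeg

/-- Coprimality gives `y = p * s` and `x = q * s` for a common `s`. -/
theorem mul_eq_lcm_of_coprime {p q x y : ℕ} (h : Nat.Coprime p q) (hxy : p * x = q * y) :
    p * x = Nat.lcm x y := by
  refine Nat.dvd_antisymm ?_ (Nat.lcm_dvd (Dvd.intro_left p rfl) (hxy ▸ Dvd.intro_left q rfl))
  obtain ⟨s, hs⟩ := h.dvd_of_dvd_mul_left (Dvd.intro x hxy : p ∣ q * y)
  rcases Nat.eq_zero_or_pos p with rfl | hp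
  · simp_all
  have hx : x = q * s := by
    subst hs
    exact Nat.eq_of_mul_eq_mul_left hp (by rw [hxy]; ring)
  subst hx hs
  rw [Nat.lcm_mul_right, h.symm.lcm_eq_mul]
  exact ⟨1, by ring⟩

theorem proposition3p7 (K : Type*) [Field K] (S : AddSubmonoid ℕ) (hS : IsNumericalSemigroup S)
    (n : ℕ) (a : Fin n → ℕ) (ha : IsMinimalArrangement a S) (hfree : IsUniversallyFree S) :
    circuits K a ⊆ universalMarkovBasis K a := by
  intro f hf
  obtain ⟨i, j, p, q, hij, hpq, hdeg, rfl⟩ := exists_single_of_mem_circuits ha.pos hf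
  have hn : 2 ≤ n := by
    have : (i : ℕ) ≠ j := fun h => hij (Fin.ext h)
    omega
  -- Indices start at 0, so `n - 2` and `n - 1` are the last two positions.
  obtain ⟨e, he1, he2⟩ := exists_perm_apply_eq (x := (⟨n - 2, by omega⟩ : Fin n))
    (y := ⟨n - 1, by omega⟩) (by rw [Ne, Fin.mk.injEq]; omega) hij
  choose c w hc hw hcw using
    exists_triangular_of_isFreeFor ha.pos e (hfree n _ (ha.comp_perm e))
  refine ⟨_, isMarkovBasis_of_triangular (K := K) ha.pos e c w hc hw (fun k hk => (hcw k hk).1)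
    (fun k hk => (hcw k hk).2.2), ⟨n - 2, by omega⟩, by dsimp only; omega, ?_⟩
  set k : Fin n := ⟨n - 2, by omega⟩ with hk
  have hlast : ∀ x : Fin n, k < x → x = ⟨n - 1, by omega⟩ := by
    intro x hx
    rw [Fin.lt_def, hk] at hx
    ext
    dsimp only at hx ⊢
    omega
  have hIoi : Finset.Ioi k = {⟨n - 1, by omega⟩} := by
    ext x
    rw [Finset.mem_Ioi, Finset.mem_singleton]
    refine ⟨hlast x, ?_⟩
    rintro rfl
    rw [Fin.lt_def, hk]
    dsimp only
    omega
  obtain ⟨h1, h2, -⟩ := hcw k (by rw [hk]; dsimp only; omega)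
  -- Only `j` follows `i`, so the gcd in the freeness condition is `a j`.
  have hck : c k = p := by
    rw [hIoi, Finset.gcd_singleton, he1, Function.comp_apply, he2, normalize_eq,
      ← mul_eq_lcm_of_coprime hpq hdeg] at h2
    exact Nat.eq_of_mul_eq_mul_right (ha.pos i) h2
  have hws : w k = Finsupp.single j (w k j) := by
    ext x
    by_cases hx : x = j
    · simp [hx]
    rw [Finsupp.single_eq_of_ne hx]
    by_contra hne
    have := hlast _ (hw k (e.symm x) (by simpa using hne))
    rw [Equiv.symm_apply_eq, he2] at this
    exact hx this
  -- As `w k` is a multiple of the last variable, its degree determines it.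
  have hwq : w k j = q := by
    rw [hws, degA_single, hck, he1, hdeg] at h1
    exact (Nat.eq_of_mul_eq_mul_right (ha.pos j) h1).symm
  rw [hws, hwq, hck, he1]
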